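/- Let $n$ be a natural number and $r = \lfloor n/2\rfloor + 1$. Call an $n\times n$ complex matrix $A=(a_{ij})$ a Toeplitz matrix if $a_{ij}=a_{kl}$ whenever $j-i=l-k$, and a Hankel matrix if $a_{ij}=a_{kl}$ whenever $i+j=k+l$. Then for every invertible matrix $A\in\mathbb{C}^{n\times n}$ there exist $2r$ Toeplitz matrices $T_1,\dots,T_{2r}\in\mathbb{C}^{n\times n}$ with $A=T_1T_2\cdots T_{2r}$, and there also exist $2r$ Hankel matrices $H_1,\dots,H_{2r}\in\mathbb{C}^{n\times n}$ with $A=H_1H_2\cdots H_{2r}$. -/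

import Mathlib

/-- A square matrix is Toeplitz if its entries are constant along the diagonals:
`A i j = A k l` whenever `j - i = l - k` (as integers). -/
def Matrix.IsToeplitz {R : Type*} {n : ℕ} (A : Matrix (Fin n) (Fin n) R) : Prop :=
  ∀ i j k l : Fin n, ((j : ℕ) : ℤ) - ((i : ℕ) : ℤ) = ((l : ℕ) : ℤ) - ((k : ℕ) : ℤ) → A i j = A k l

/-- A square matrix is Hankel if its entries are constant along the reverse diagonals:
`A i j = A k l` whenever `i + j = k + l` (as natural numbers). -/
def Matrix.IsHankel {R : Type*} {n : ℕ} (A : Matrix (Fin n) (Fin n) R) : Prop :=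
  ∀ i j k l : Fin n, (i : ℕ) + (j : ℕ) = (k : ℕ) + (l : ℕ) → A i j = A k l

open MvPolynomial Topology
open scoped Matrix.Norms.Operator Pointwise


/-! A generic matrix is a product of `r` Toeplitz matrices, and an invertible `A` equals `g * (g⁻¹ *
A)` with both factors generic. For genericity, by Chevalley's theorem, it suffices that
multiplication of `r` Toeplitz matrices has surjective differential at one point. That point is `T i
= 1 + t • D i` with `D i = toeplitzDirection ℂ n i` and `t` small: as `t → 0` the images of the
differentials accumulate on all Toeplitz `X` and all `D i * X - X * D (i + 1)`, which span
everything (`eq_top_of_toeplitzDirection_mem`). Reversing the order of rows or columns turns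
Toeplitz factors into Hankel ones. -/

theorem Topology.IsConstructible.exists_isOpen_subset_or_subset_compl {X : Type*}
    [TopologicalSpace X] [IrreducibleSpace X] {s : Set X} (hs : IsConstructible s) :
    ∃ U : Set X, IsOpen U ∧ U.Nonempty ∧ (U ⊆ s ∨ U ⊆ sᶜ) := by
  induction hs using IsConstructible.empty_union_induction with
  | open_retrocompact U hU _ =>
    rcases U.eq_empty_or_nonempty with rfl | h
    · exact ⟨Set.univ, isOpen_univ, Set.univ_nonempty, by simp⟩
    · exact ⟨U, hU, h, Or.inl subset_rfl⟩
  | union s _ t _ ihs iht =>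
    obtain ⟨U, hU, hU0, hUs⟩ := ihs
    obtain ⟨V, hV, hV0, hVt⟩ := iht
    rcases hUs with hUs | hUs
    · exact ⟨U, hU, hU0, Or.inl (hUs.trans Set.subset_union_left)⟩
    rcases hVt with hVt | hVt
    · exact ⟨V, hV, hV0, Or.inl (hVt.trans Set.subset_union_right)⟩
    refine ⟨U ∩ V, hU.inter hV, nonempty_preirreducible_inter hU hV hU0 hV0, Or.inr ?_⟩
    rw [Set.compl_union]
    exact Set.inter_subset_inter hUs hVt
  | compl s _ ih =>
    obtain ⟨U, hU, hU0, hUs⟩ := ih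
    exact ⟨U, hU, hU0, by rw [compl_compl]; exact hUs.symm⟩

/-! ### Dominant polynomial maps. -/

namespace MvPolynomial

/-- The image of a dominant polynomial map over an algebraically closed field contains the
complement of a hypersurface. -/
theorem exists_ne_zero_forall_exists_eval_eq {ι κ K : Type*} [Finite ι] [Finite κ] [Field K]
    [IsAlgClosed K] {p : ι → MvPolynomial κ K} (hp : AlgebraicIndependent K p) :
    ∃ f : MvPolynomial ι K, f ≠ 0 ∧
      ∀ y : ι → K, eval y f ≠ 0 → ∃ x : κ → K, ∀ i, eval x (p i) = y i := by
  let φ : MvPolynomial ι K →ₐ[K] MvPolynomial κ K := aeval p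
  have hφ : Function.Injective φ := hp
  have hfin : φ.toRingHom.FinitePresentation := by
    apply RingHom.FinitePresentation.of_finiteType.mp
    have : (φ.toRingHom.comp (algebraMap K _)).FiniteType := by
      rw [AlgHom.toRingHom_eq_coe, AlgHom.comp_algebraMap]
      exact RingHom.finiteType_algebraMap.mpr inferInstance
    exact RingHom.FiniteType.of_comp_finiteType this
  obtain ⟨U, hU, ⟨u, hu⟩, hUs⟩ :=
    (PrimeSpectrum.isConstructible_range_comap hfin).exists_isOpen_subset_or_subset_compl
  obtain ⟨_, ⟨_, ⟨f, rfl⟩, rfl⟩, huf, hfU⟩ :=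
    PrimeSpectrum.isBasis_basic_opens.exists_subset_of_mem_open hu hU
  have hf : f ≠ 0 := by
    rintro rfl
    simp at huf
  have hUr : (PrimeSpectrum.basicOpen f : Set _) ⊆ Set.range (PrimeSpectrum.comap φ.toRingHom) := by
    rcases hUs with h | h
    · exact hfU.trans h
    -- Injectivity of `φ` puts the generic point in the range, and every nonempty open set contains
    -- it.
    · exfalso
      have h0 : (⊥ : PrimeSpectrum (MvPolynomial ι K)) ∈ (PrimeSpectrum.basicOpen f : Set _) := by
        simpa using hf
      refine h (hfU h0) ⟨⊥, ?_⟩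
      ext1
      exact (RingHom.ker_eq_comap_bot _).symm.trans ((RingHom.injective_iff_ker_eq_bot _).mp hφ)
  refine ⟨f, hf, fun y hy ↦ ?_⟩
  obtain ⟨P, hP⟩ := hUr (show pointToPoint (k := K) y ∈ _ by
    change f ∉ vanishingIdeal K {y}
    rwa [mem_vanishingIdeal_singleton_iff, aeval_eq_eval])
  -- A closed point above `P` still lies over `y`, since the ideal of `y` already pulls back from
  -- `P`.
  obtain ⟨m, hm, hPm⟩ := Ideal.exists_le_maximal P.asIdeal P.isPrime.ne_top
  obtain ⟨x, rfl⟩ := eq_vanishingIdeal_singleton_of_isMaximal K hm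
  refine ⟨x, fun i ↦ ?_⟩
  have h1 : X i - C (y i) ∈ (pointToPoint (k := K) y).asIdeal := by
    change X i - C (y i) ∈ vanishingIdeal K {y}
    simp
  rw [← hP] at h1
  have h2 := hPm h1
  rw [mem_vanishingIdeal_singleton_iff] at h2
  simpa [φ, sub_eq_zero, aeval_eq_eval] using h2

theorem eq_zero_of_eventually_eval_eq_zero {ι : Type*} [Finite ι] {f : MvPolynomial ι ℂ}
    {x : ι → ℂ} (h : ∀ᶠ y in 𝓝 x, eval y f = 0) : f = 0 := by
  have := Fintype.ofFinite ι
  obtain ⟨ε, hε, hs⟩ := Metric.eventually_nhds_iff_ball.mp h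
  refine funext_set (fun i ↦ Metric.ball (x i) ε) (fun i ↦ ?_) fun y hy ↦ ?_
  · exact infinite_of_mem_nhds (x i) (Metric.ball_mem_nhds _ hε)
  · rw [map_zero]
    apply hs
    rwa [ball_pi _ hε]

theorem dense_setOf_eval_ne_zero {ι : Type*} [Finite ι] {f : MvPolynomial ι ℂ} (hf : f ≠ 0) :
    Dense {y | eval y f ≠ 0} := by
  intro x
  rw [mem_closure_iff_frequently]
  intro h
  exact hf (eq_zero_of_eventually_eval_eq_zero (by simpa using h))

theorem algebraicIndependent_of_range_mem_nhds {ι κ : Type*} [Finite ι]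
    {p : ι → MvPolynomial κ ℂ} {y : ι → ℂ}
    (h : Set.range (fun (x : κ → ℂ) i ↦ eval x (p i)) ∈ 𝓝 y) : AlgebraicIndependent ℂ p := by
  rw [algebraicIndependent_iff]
  intro f hf
  apply eq_zero_of_eventually_eval_eq_zero (x := y)
  filter_upwards [h]
  rintro _ ⟨x, rfl⟩
  have := congrArg (eval x) hf
  rw [map_zero, aeval_def, algebraMap_eq, hom_eval₂] at this
  rwa [show (eval x).comp C = RingHom.id ℂ from RingHom.ext fun c ↦ by simp] at this

end MvPolynomial

/-! ### Shift matrices and spanning modulo Toeplitz matrices. -/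

namespace Matrix

variable {R : Type*} {n : ℕ}

/-- The submodule of Toeplitz matrices. -/
def toeplitz (R : Type*) [CommRing R] (n : ℕ) : Submodule R (Matrix (Fin n) (Fin n) R) where
  carrier := {A | A.IsToeplitz}
  add_mem' hA hB i j k l h := by simp [hA i j k l h, hB i j k l h]
  zero_mem' i j k l h := rfl
  smul_mem' c A hA i j k l h := by simp [hA i j k l h]

/-- The matrix with ones on the `k`-th superdiagonal. -/
def upShift (R : Type*) [CommRing R] (n k : ℕ) : Matrix (Fin n) (Fin n) R :=
  of fun i j ↦ if (i : ℕ) + k = j then 1 else 0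

/-- The matrix with ones on the `k`-th subdiagonal. -/
def downShift (R : Type*) [CommRing R] (n k : ℕ) : Matrix (Fin n) (Fin n) R :=
  of fun i j ↦ if (i : ℕ) = j + k then 1 else 0

variable [CommRing R]

theorem one_mem_toeplitz : (1 : Matrix (Fin n) (Fin n) R) ∈ toeplitz R n := by
  intro i j k l h
  simp only [one_apply, Fin.ext_iff]
  congr 1
  simp only [eq_iff_iff]
  omega

theorem upShift_mem_toeplitz (k : ℕ) : upShift R n k ∈ toeplitz R n := by
  intro i j i' j' h
  simp only [upShift, of_apply]
  congr 1
  simp only [eq_iff_iff]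
  omega

theorem downShift_mem_toeplitz (k : ℕ) : downShift R n k ∈ toeplitz R n := by
  intro i j i' j' h
  simp only [downShift, of_apply]
  congr 1
  simp only [eq_iff_iff]
  omega

theorem upShift_eq_zero {k : ℕ} (hk : n ≤ k) : upShift R n k = 0 := by
  ext i j
  simp only [upShift, of_apply, zero_apply, ite_eq_right_iff]
  omega

theorem downShift_eq_zero {k : ℕ} (hk : n ≤ k) : downShift R n k = 0 := by
  ext i j
  simp only [downShift, of_apply, zero_apply, ite_eq_right_iff]
  omega

theorem upShift_mul_upShift (k l : ℕ) : upShift R n k * upShift R n l = upShift R n (k + l) := by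
  ext i j
  simp only [upShift, mul_apply, of_apply, mul_ite, mul_one, mul_zero, ← ite_and]
  by_cases h : (i : ℕ) + (k + l) = j
  · rw [if_pos h, Finset.sum_eq_single ⟨i + k, by omega⟩]
    · rw [if_pos (by simp; omega)]
    · intro c _ hc
      rw [Ne, Fin.ext_iff] at hc
      rw [if_neg (by simp at hc; omega)]
    · simp
  · rw [if_neg h]
    exact Finset.sum_eq_zero fun c _ ↦ if_neg (by omega)

theorem downShift_mul_downShift (k l : ℕ) :
    downShift R n k * downShift R n l = downShift R n (k + l) := by
  ext i j
  simp only [downShift, mul_apply, of_apply, mul_ite, mul_one, mul_zero, ← ite_and]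
  by_cases h : (i : ℕ) = j + (k + l)
  · rw [if_pos h, Finset.sum_eq_single ⟨j + l, by omega⟩]
    · rw [if_pos (by simp; omega)]
    · intro c _ hc
      rw [Ne, Fin.ext_iff] at hc
      rw [if_neg (by simp at hc; omega)]
    · simp
  · rw [if_neg h]
    exact Finset.sum_eq_zero fun c _ ↦ if_neg (by omega)

theorem upShift_mul_downShift_apply (k q : ℕ) (i j : Fin n) :
    (upShift R n k * downShift R n q) i j = if (i : ℕ) + k = j + q ∧ i + k < n then 1 else 0 := by
  simp only [upShift, downShift, mul_apply, of_apply, mul_ite, mul_one, mul_zero, ← ite_and]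
  by_cases h : (i : ℕ) + k = j + q ∧ i + k < n
  · rw [if_pos h, Finset.sum_eq_single ⟨i + k, by omega⟩]
    · rw [if_pos (by simp; omega)]
    · intro c _ hc
      rw [Ne, Fin.ext_iff] at hc
      rw [if_neg (by simp at hc; omega)]
    · simp
  · rw [if_neg h]
    exact Finset.sum_eq_zero fun c _ ↦ if_neg (by omega)

theorem downShift_mul_upShift_apply (q k : ℕ) (i j : Fin n) :
    (downShift R n q * upShift R n k) i j = if (i : ℕ) + k = j + q ∧ q ≤ i then 1 else 0 := by
  simp only [upShift, downShift, mul_apply, of_apply, mul_ite, mul_one, mul_zero, ← ite_and]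
  by_cases h : (i : ℕ) + k = j + q ∧ q ≤ i
  · rw [if_pos h, Finset.sum_eq_single ⟨i - q, by omega⟩]
    · rw [if_pos (by simp; omega)]
    · intro c _ hc
      rw [Ne, Fin.ext_iff] at hc
      rw [if_neg (by simp at hc; omega)]
    · simp
  · rw [if_neg h]
    exact Finset.sum_eq_zero fun c _ ↦ if_neg (by omega)

/-- The two products are complementary pieces of one diagonal, so modulo Toeplitz matrices an
up-down product is minus a down-up product. -/
theorem upShift_mul_downShift_add_mem_toeplitz {k q : ℕ} (hk : k ≤ n) (hq : q ≤ n) :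
    upShift R n k * downShift R n q + downShift R n (n - k) * upShift R n (n - q) ∈
      toeplitz R n := by
  have key : upShift R n k * downShift R n q + downShift R n (n - k) * upShift R n (n - q) =
      of fun i j : Fin n ↦ if (i : ℕ) + k = j + q then 1 else 0 := by
    ext i j
    rw [add_apply, upShift_mul_downShift_apply, downShift_mul_upShift_apply, of_apply]
    split_ifs <;> first | omega | simp
  rw [key]
  intro i j i' j' h
  simp only [of_apply]
  congr 1
  simp only [eq_iff_iff]
  omega

theorem downShift_mul_upShift_sub (i j : Fin n) :
    downShift R n i * upShift R n j - downShift R n (i + 1) * upShift R n (j + 1) =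
      single i j 1 := by
  ext a b
  rw [sub_apply, downShift_mul_upShift_apply, downShift_mul_upShift_apply, single_apply]
  simp only [Fin.ext_iff]
  split_ifs <;> first | omega | simp

/-- First order perturbations of the identity at which the multiplication map on tuples of Toeplitz
matrices is submersive. -/
def toeplitzDirection (R : Type*) [CommRing R] (n i : ℕ) : Matrix (Fin n) (Fin n) R :=
  upShift R n (n / 2 + 1 + i) + if i < n / 2 then downShift R n (n - 1 - i) else 0

theorem toeplitzDirection_mem_toeplitz (i : ℕ) : toeplitzDirection R n i ∈ toeplitz R n := by
  unfold toeplitzDirection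
  refine add_mem (upShift_mem_toeplitz _) ?_
  split_ifs
  exacts [downShift_mem_toeplitz _, zero_mem _]

/-- Testing `h` on shifts gives `g a j ≡ -g j (a + 1)` modulo `V`, except that `g a j ∈ V` at the
ends of the two chains of indices `a`. Applying this twice raises both indices by one, so every `g a
j` eventually dies. -/
theorem eq_top_of_toeplitzDirection_mem {V : Submodule R (Matrix (Fin n) (Fin n) R)}
    (hV : toeplitz R n ≤ V)
    (h : ∀ i < n / 2, ∀ X ∈ toeplitz R n,
      toeplitzDirection R n i * X - X * toeplitzDirection R n (i + 1) ∈ V) : V = ⊤ := by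
  let g (a b : ℕ) := downShift R n (n - 1 - a) * upShift R n (b + 1)
  have up {i j : ℕ} (hi : i < n / 2) (hj : j < n - 1) :
      g i j + (if i + 1 < n / 2 then g j (i + 1) else 0) ∈ V := by
    have h1 := h i hi _ (upShift_mem_toeplitz (j + 1))
    have h2 := hV (upShift_mem_toeplitz (R := R) (n := n) (n / 2 + 1 + i + (j + 1)))
    have h3 := hV (upShift_mem_toeplitz (R := R) (n := n) (j + 1 + (n / 2 + 1 + (i + 1))))
    rw [← upShift_mul_upShift] at h2 h3
    simp only [toeplitzDirection, if_pos hi] at h1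
    split_ifs at h1 ⊢ with hi'
    · have h4 := hV (upShift_mul_downShift_add_mem_toeplitz (R := R) (n := n) (k := j + 1)
        (q := n - 1 - (i + 1)) (by omega) (by omega))
      rw [show n - (j + 1) = n - 1 - j by omega,
        show n - (n - 1 - (i + 1)) = i + 1 + 1 by omega] at h4
      convert V.add_mem (V.add_mem (V.sub_mem h1 h2) h3) h4 using 1
      simp only [g]
      noncomm_ring
    · convert V.add_mem (V.sub_mem h1 h2) h3 using 1
      simp only [g]
      noncomm_ring
  have down {i j : ℕ} (hi : i < n / 2) (hin : n / 2 + i < n - 1) (hj : j < n - 1) :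
      g (n / 2 + i) j + g j (n / 2 + i + 1) ∈ V := by
    have h1 := h i hi _ (downShift_mem_toeplitz (n - 1 - j))
    have h2 := hV (downShift_mem_toeplitz (R := R) (n := n) (n - 1 - i + (n - 1 - j)))
    have h3 := hV (downShift_mem_toeplitz (R := R) (n := n) (n - 1 - j + (n - 1 - (i + 1))))
    have h4 := hV (upShift_mul_downShift_add_mem_toeplitz (R := R) (n := n)
        (k := n / 2 + 1 + i) (q := n - 1 - j) (by omega) (by omega))
    rw [← downShift_mul_downShift] at h2 h3
    rw [show n - (n / 2 + 1 + i) = n - 1 - (n / 2 + i) by omega,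
        show n - (n - 1 - j) = j + 1 by omega] at h4
    simp only [toeplitzDirection, if_pos hi] at h1
    rw [show n / 2 + 1 + (i + 1) = n / 2 + i + 1 + 1 by omega] at h1
    split_ifs at h1 with hi'
    · convert V.sub_mem (V.sub_mem h4 h1) (V.sub_mem h3 h2) using 1
      simp only [g]
      noncomm_ring
    · convert V.add_mem (V.sub_mem h4 h1) h2 using 1
      simp only [g]
      noncomm_ring
  have step {a j : ℕ} (ha : a < n - 1) (hj : j < n - 1) :
      g a j ∈ V ∨ a + 1 < n - 1 ∧ g a j + g j (a + 1) ∈ V := by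
    by_cases h1 : a < n / 2
    · have := up h1 hj
      split_ifs at this with h2
      · exact Or.inr ⟨by omega, this⟩
      · exact Or.inl (by simpa using this)
    · have := down (i := a - n / 2) (j := j) (by omega) (by omega) hj
      rw [show n / 2 + (a - n / 2) = a by omega] at this
      by_cases h2 : a + 1 < n - 1
      · exact Or.inr ⟨h2, this⟩
      -- Here `a + 1 = n - 1`, and the second term contains `upShift R n n = 0`.
      · left
        simpa [g, upShift_eq_zero (R := R) (show n ≤ a + 1 + 1 by omega)] using this
  have hg (d : ℕ) : ∀ a j, a + d = n - 1 → a < n - 1 → j < n - 1 → g a j ∈ V := by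
    induction d with
    | zero => intro a j h1 h2; omega
    | succ d ih =>
      intro a j had ha hj
      rcases step ha hj with h1 | ⟨ha', h1⟩
      · exact h1
      refine (V.add_mem_iff_left ?_).mp h1
      rcases step hj ha' with h2 | ⟨hj', h2⟩
      · exact h2
      exact (V.add_mem_iff_left (ih _ _ (by omega) ha' hj')).mp h2
  have hdu (q k : ℕ) : downShift R n q * upShift R n k ∈ V := by
    by_cases hq : n ≤ q
    · simp [downShift_eq_zero hq]
    by_cases hk : n ≤ k
    · simp [upShift_eq_zero hk]
    rcases Nat.eq_zero_or_pos q with rfl | hq0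
    · convert hV (upShift_mem_toeplitz k) using 1
      rw [show downShift R n 0 = 1 by ext i j; simp [downShift, one_apply, Fin.ext_iff], one_mul]
    rcases Nat.eq_zero_or_pos k with rfl | hk0
    · convert hV (downShift_mem_toeplitz q) using 1
      rw [show upShift R n 0 = 1 by ext i j; simp [upShift, one_apply, Fin.ext_iff], mul_one]
    have := hg q (n - 1 - q) (k - 1) (by omega) (by omega) (by omega)
    simp only [g] at this
    rwa [show n - 1 - (n - 1 - q) = q by omega, show k - 1 + 1 = k by omega] at this
  rw [eq_top_iff]
  intro A _
  rw [matrix_eq_sum_single A]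
  refine sum_mem fun i _ ↦ sum_mem fun j _ ↦ ?_
  rw [← mul_one (A i j), ← smul_eq_mul, ← smul_single, ← downShift_mul_upShift_sub]
  exact V.smul_mem _ (V.sub_mem (hdu _ _) (hdu _ _))

end Matrix

/-! ### Surjectivity of the differential near the identity. -/

/-- Linear independence is an open condition: curves through a basis at `0` still form a basis at
small `t ≠ 0`. -/
theorem Submodule.exists_ne_zero_eq_top_of_continuousAt {𝕜 E : Type*} [NontriviallyNormedField 𝕜]
    [CompleteSpace 𝕜] [NormedAddCommGroup E] [NormedSpace 𝕜 E] [FiniteDimensional 𝕜 E]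
    {W : 𝕜 → Submodule 𝕜 E}
    (h : ∀ x, ∃ γ : 𝕜 → E, ContinuousAt γ 0 ∧ γ 0 = x ∧ ∀ t ≠ 0, γ t ∈ W t) :
    ∃ t ≠ 0, W t = ⊤ := by
  choose γ hγ hγ0 hγW using h
  let b := Module.finBasis 𝕜 E
  have hc : ContinuousAt (fun t i ↦ γ (b i) t) 0 := continuousAt_pi.mpr fun i ↦ hγ (b i)
  have hli : LinearIndependent 𝕜 (fun i ↦ γ (b i) 0) := by
    simpa only [hγ0] using b.linearIndependent
  have hev := (hc.eventually hli.eventually).filter_mono (nhdsWithin_le_nhds (s := {0}ᶜ))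
  obtain ⟨t, ht, ht0⟩ := (hev.and self_mem_nhdsWithin).exists
  refine ⟨t, ht0, eq_top_iff.mpr ?_⟩
  rw [← ht.span_eq_top_of_card_eq_finrank' (by simp), Submodule.span_le]
  rintro _ ⟨i, rfl⟩
  exact hγW _ _ ht0

namespace Matrix

variable {n : ℕ}

/-- The image of the differential at `T` of the multiplication map on tuples of Toeplitz
matrices. -/
def toeplitzTangent {r : ℕ} (T : Fin r → Matrix (Fin n) (Fin n) ℂ) :
    Submodule ℂ (Matrix (Fin n) (Fin n) ℂ) :=
  Submodule.span ℂ {Y | ∃ i : Fin r, ∃ X ∈ toeplitz ℂ n,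
    Y = (((List.finRange r).take i).map T).prod * X *
      (((List.finRange r).drop (i + 1)).map T).prod}

theorem exists_toeplitzTangent_eq_top (n : ℕ) :
    ∃ T : Fin (n / 2 + 1) → Matrix (Fin n) (Fin n) ℂ,
      (∀ i, T i ∈ toeplitz ℂ n) ∧ toeplitzTangent T = ⊤ := by
  let T (t : ℂ) (i : Fin (n / 2 + 1)) := 1 + t • toeplitzDirection ℂ n i
  have hT (t : ℂ) (i) : T t i ∈ toeplitz ℂ n :=
    add_mem one_mem_toeplitz (Submodule.smul_mem _ _ (toeplitzDirection_mem_toeplitz _))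
  suffices ∃ t ≠ 0, toeplitzTangent (T t) = ⊤ by
    obtain ⟨t, -, ht⟩ := this
    exact ⟨T t, hT t, ht⟩
  apply Submodule.exists_ne_zero_eq_top_of_continuousAt
  have hcont (l : List (Fin (n / 2 + 1))) : Continuous fun t ↦ (l.map (T t)).prod := by
    refine continuous_list_prod _ fun i _ ↦ ?_
    fun_prop
  have hone (l : List (Fin (n / 2 + 1))) : (l.map (T 0)).prod = 1 := by
    simp [T]
  let Γ : Submodule ℂ (Matrix (Fin n) (Fin n) ℂ) :=
    { carrier := {x | ∃ γ : ℂ → Matrix (Fin n) (Fin n) ℂ, ContinuousAt γ 0 ∧ γ 0 = x ∧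
        ∀ t ≠ 0, γ t ∈ toeplitzTangent (T t)}
      add_mem' := by
        rintro _ _ ⟨γ, hγ, rfl, hγ'⟩ ⟨δ, hδ, rfl, hδ'⟩
        exact ⟨γ + δ, hγ.add hδ, rfl, fun t ht ↦ add_mem (hγ' t ht) (hδ' t ht)⟩
      zero_mem' := ⟨0, continuousAt_const, rfl, fun t _ ↦ zero_mem _⟩
      smul_mem' := by
        rintro c _ ⟨γ, hγ, rfl, hγ'⟩
        exact ⟨c • γ, hγ.const_smul c, rfl, fun t ht ↦ Submodule.smul_mem _ c (hγ' t ht)⟩ }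
  have hmem (t : ℂ) (i : Fin (n / 2 + 1)) {X} (hX : X ∈ toeplitz ℂ n) :
      (((List.finRange _).take i).map (T t)).prod * X *
        (((List.finRange _).drop (i + 1)).map (T t)).prod ∈ toeplitzTangent (T t) :=
    Submodule.subset_span ⟨i, X, hX, rfl⟩
  suffices hΓ : Γ = ⊤ by
    intro x
    exact hΓ.symm.le (Submodule.mem_top (x := x))
  apply eq_top_of_toeplitzDirection_mem
  · intro X hX
    refine ⟨_, ?_, ?_, fun t _ ↦ hmem t 0 hX⟩
    · exact ((continuous_const.mul continuous_const).mul (hcont _)).continuousAt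
    · simp only [hone, one_mul, mul_one]
  · intro i hi X hX
    refine ⟨fun t ↦ (((List.finRange (n / 2 + 1)).take i).map (T t)).prod *
      (toeplitzDirection ℂ n i * X - X * toeplitzDirection ℂ n (i + 1)) *
        (((List.finRange (n / 2 + 1)).drop (i + 1 + 1)).map (T t)).prod, ?_, ?_, fun t ht ↦ ?_⟩
    · exact (((hcont _).mul continuous_const).mul (hcont _)).continuousAt
    · simp only [hone, one_mul, mul_one]
    · have h1 := hmem t ⟨i + 1, by omega⟩ hX
      have h2 := hmem t ⟨i, by omega⟩ hX
      have h3 : (List.finRange (n / 2 + 1)).take (i + 1) =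
          (List.finRange (n / 2 + 1)).take i ++ [⟨i, by omega⟩] := by
        rw [← List.take_concat_get' (List.finRange (n / 2 + 1)) i (by simp; omega)]
        simp
      have h4 : (List.finRange (n / 2 + 1)).drop (i + 1) =
          ⟨i + 1, by omega⟩ :: (List.finRange (n / 2 + 1)).drop (i + 1 + 1) := by
        rw [List.drop_eq_getElem_cons (by simp; omega)]
        simp
      simp only [h3, List.map_append, List.prod_append, List.map_cons, List.map_nil,
        List.prod_singleton] at h1
      simp only [h4, List.map_cons, List.prod_cons] at h2
      -- In the difference of neighbouring tangent vectors the order-zero terms cancel, leaving `t`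
      -- times the curve.
      rw [← Submodule.smul_mem_iff _ ht]
      convert sub_mem h1 h2 using 1
      simp only [T]
      simp only [add_mul, mul_add, mul_sub, sub_mul, smul_sub, one_mul, mul_one, smul_mul_assoc,
        mul_smul_comm, mul_assoc]
      abel

/-! ### Generic and invertible matrices as Toeplitz products. -/

/-- The entries of a matrix, as a family indexed by pairs. -/
def entriesHomeomorph (n : ℕ) : Matrix (Fin n) (Fin n) ℂ ≃ₜ (Fin n × Fin n → ℂ) where
  toFun A i := A i.1 i.2
  invFun y := of fun i j ↦ y (i, j)
  left_inv _ := rfl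
  right_inv _ := rfl
  continuous_toFun := continuous_pi fun i ↦ continuous_id.matrix_elem i.1 i.2
  continuous_invFun := continuous_matrix fun i j ↦ continuous_apply (i, j)

theorem exists_forall_mem_toeplitz_pow (n : ℕ) :
    ∃ f : MvPolynomial (Fin n × Fin n) ℂ, f ≠ 0 ∧ ∀ A : Matrix (Fin n) (Fin n) ℂ,
      eval (fun i ↦ A i.1 i.2) f ≠ 0 → A ∈ (toeplitz ℂ n : Set _) ^ (n / 2 + 1) := by
  let toep (R : Type) (c : Fin (2 * n - 1) → R) : Matrix (Fin n) (Fin n) R :=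
    of fun i j ↦ c ⟨i + j.rev, by omega⟩
  have htoep (c) : toep ℂ c ∈ (toeplitz ℂ n : Set (Matrix (Fin n) (Fin n) ℂ)) := by
    intro i j k l h
    simp only [toep, of_apply]
    congr 2
    simp only [Fin.val_rev]
    omega
  have hsurj (A) (hA : A ∈ toeplitz ℂ n) : ∃ c, toep ℂ c = A := by
    rcases Nat.eq_zero_or_pos n with rfl | hn
    · exact ⟨0, Subsingleton.elim _ _⟩
    -- Truncated subtraction selects the entry of diagonal `k` in the first row or first column.
    refine ⟨fun k ↦ A ⟨k - (n - 1), by omega⟩ ⟨n - 1 - k, by omega⟩, ?_⟩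
    ext i j
    apply hA
    simp only [Fin.val_rev]
    omega
  let P : Matrix (Fin n) (Fin n) (MvPolynomial (Fin (n / 2 + 1) × Fin (2 * n - 1)) ℂ) :=
    ((List.finRange (n / 2 + 1)).map fun i ↦ toep _ fun k ↦ X (i, k)).prod
  have hP (x : Fin (n / 2 + 1) × Fin (2 * n - 1) → ℂ) (i j) : eval x (P i j) =
      ((List.finRange (n / 2 + 1)).map fun i ↦ toep ℂ fun k ↦ x (i, k)).prod i j := by
    have : (eval x).mapMatrix P =
        ((List.finRange (n / 2 + 1)).map fun i ↦ toep ℂ fun k ↦ x (i, k)).prod := by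
      rw [map_list_prod, List.map_map]
      congr 2
      ext i a b
      simp [toep]
    rw [← this]
    rfl
  let toepₗ : (Fin (2 * n - 1) → ℂ) →ₗ[ℂ] Matrix (Fin n) (Fin n) ℂ :=
    { toFun := toep ℂ, map_add' := fun _ _ ↦ rfl, map_smul' := fun _ _ ↦ rfl }
  let D (i : Fin (n / 2 + 1)) :
      (Fin (n / 2 + 1) → Fin (2 * n - 1) → ℂ) →L[ℂ] Matrix (Fin n) (Fin n) ℂ :=
    toepₗ.toContinuousLinearMap.comp (ContinuousLinearMap.proj i)
  obtain ⟨T, hT, htop⟩ := exists_toeplitzTangent_eq_top n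
  choose c hc using fun i ↦ hsurj (T i) (hT i)
  have hderiv := HasStrictFDerivAt.list_prod' (𝕜 := ℂ) (l := List.finRange (n / 2 + 1))
    (f := fun i x ↦ D i x) (f' := D) (x := c) fun i _ ↦ (D i).hasStrictFDerivAt
  have hnhds := hderiv.map_nhds_eq_of_surj (by
    rw [eq_top_iff, ← htop, toeplitzTangent, Submodule.span_le]
    rintro _ ⟨i, X, hX, rfl⟩
    obtain ⟨y, rfl⟩ := hsurj X hX
    refine ⟨Pi.single i y, ?_⟩
    have hT' (j) : D j c = T j := hc j
    simp only [ContinuousLinearMap.coe_coe, _root_.sum_apply, _root_.smul_apply, smul_eq_mul]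
    rw [Finset.sum_eq_single (Fin.cast (by simp) i)]
    · have hDi : D i (Pi.single i y) = toep ℂ y := by simp [D]; rfl
      change _ * (D _ _ * _) = _
      simp [hT', hDi, mul_assoc]
    · intro j _ hj
      have hij : Fin.cast (by simp) j ≠ i := by
        rintro rfl
        simp at hj
      have hDj : D (Fin.cast (by simp) j) (Pi.single i y) = 0 := by simp [D, hij]
      change _ * (D _ _ * _) = _
      simp [hDj]
    · simp)
  have hind : AlgebraicIndependent ℂ fun i : Fin n × Fin n ↦ P i.1 i.2 := by
    refine algebraicIndependent_of_range_mem_nhds (Filter.mem_of_superset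
      ((entriesHomeomorph n).isOpenMap.image_mem_nhds (hnhds ▸ Filter.range_mem_map)) ?_)
    rintro _ ⟨_, ⟨x, rfl⟩, rfl⟩
    exact ⟨fun k ↦ x k.1 k.2, funext fun i ↦ hP _ _ _⟩
  obtain ⟨f, hf, h⟩ := exists_ne_zero_forall_exists_eval_eq hind
  refine ⟨f, hf, fun A hA ↦ ?_⟩
  obtain ⟨x, hx⟩ := h _ hA
  rw [Set.mem_pow]
  refine ⟨fun i ↦ ⟨toep ℂ fun k ↦ x (i, k), htoep fun k ↦ x (i, k)⟩, ?_⟩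
  ext i j
  rw [← hx (i, j), hP, List.ofFn_eq_map]

theorem mem_toeplitz_pow_of_isUnit {A : Matrix (Fin n) (Fin n) ℂ} (hA : IsUnit A) :
    A ∈ (toeplitz ℂ n : Set _) ^ (2 * (n / 2 + 1)) := by
  obtain ⟨f, hf, h⟩ := exists_forall_mem_toeplitz_pow n
  obtain ⟨a, rfl⟩ := hA
  let S : Set (Matrix (Fin n) (Fin n) ℂ)ˣ := {g | eval (fun i ↦ g.1 i.1 i.2) f ≠ 0}
  have hSo : IsOpen S := isOpen_ne.preimage
    ((f.continuous_eval.comp (entriesHomeomorph n).continuous).comp Units.continuous_val)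
  have hSd : Dense S := ((dense_setOf_eval_ne_zero hf).preimage
    (entriesHomeomorph n).isOpenMap).preimage Units.isOpenEmbedding_val.isOpenMap
  -- The map `g ↦ g⁻¹ * a`; some `g` has both `g` and its image in the dense open set `S`.
  let e : (Matrix (Fin n) (Fin n) ℂ)ˣ ≃ₜ (Matrix (Fin n) (Fin n) ℂ)ˣ :=
    (Homeomorph.inv _).trans (Homeomorph.mulRight a)
  obtain ⟨g, hg, hg'⟩ := (hSd.inter_of_isOpen_left (hSd.preimage e.isOpenMap) hSo).nonempty
  rw [two_mul, pow_add]
  refine ⟨g, h _ hg, _, h _ hg', ?_⟩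
  simp [e]

/-! ### Passage to Hankel matrices. -/

/-- The exchange matrix. -/
def exchange (n : ℕ) : Matrix (Fin n) (Fin n) ℂ := of fun i j ↦ if i.rev = j then 1 else 0

theorem IsToeplitz.mul_exchange {A : Matrix (Fin n) (Fin n) ℂ} (hA : A.IsToeplitz) :
    (A * exchange n).IsHankel := by
  have key (i j) : (A * exchange n) i j = A i j.rev := by
    simp [mul_apply, exchange, Fin.rev_eq_iff]
  intro i j k l h
  rw [key, key]
  apply hA
  simp only [Fin.val_rev]
  omega

theorem IsToeplitz.exchange_mul {A : Matrix (Fin n) (Fin n) ℂ} (hA : A.IsToeplitz) :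
    (exchange n * A).IsHankel := by
  have key (i j) : (exchange n * A) i j = A i.rev j := by
    simp [mul_apply, exchange]
  intro i j k l h
  rw [key, key]
  apply hA
  simp only [Fin.val_rev]
  omega

theorem exchange_mul_exchange : exchange n * exchange n = 1 := by
  ext i j
  simp only [mul_apply, exchange, of_apply, ite_mul, one_mul, zero_mul]
  simp [one_apply]

/-- With `J` the exchange matrix, `J * J = 1` gives `A * B = (A * J) * (J * B)`; pairing the factors
needs an even number of them. -/
theorem toeplitz_pow_subset_hankel_pow (r : ℕ) :
    (toeplitz ℂ n : Set (Matrix (Fin n) (Fin n) ℂ)) ^ (2 * r) ⊆ {A | A.IsHankel} ^ (2 * r) := by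
  rw [pow_mul, pow_mul]
  refine Set.pow_subset_pow_left ?_
  rw [sq, sq]
  rintro _ ⟨A, hA, B, hB, rfl⟩
  refine ⟨A * exchange n, IsToeplitz.mul_exchange hA, exchange n * B,
    IsToeplitz.exchange_mul hB, ?_⟩
  simp only [mul_assoc, ← mul_assoc (exchange n), exchange_mul_exchange, one_mul]

end Matrix

theorem mainTheorem4 (n r : ℕ) (hr : r = n / 2 + 1) (A : Matrix (Fin n) (Fin n) ℂ)
    (hA : IsUnit A) :
    (∃ T : Fin (2 * r) → Matrix (Fin n) (Fin n) ℂ,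
      (∀ i, (T i).IsToeplitz) ∧ A = (List.ofFn T).prod) ∧
    (∃ H : Fin (2 * r) → Matrix (Fin n) (Fin n) ℂ,
      (∀ i, (H i).IsHankel) ∧ A = (List.ofFn H).prod) := by
  subst hr
  have hT := Matrix.mem_toeplitz_pow_of_isUnit hA
  obtain ⟨H, hH⟩ := Set.mem_pow.mp (Matrix.toeplitz_pow_subset_hankel_pow _ hT)
  obtain ⟨T, hT⟩ := Set.mem_pow.mp hT
  exact ⟨⟨fun i ↦ T i, fun i ↦ (T i).2, hT.symm⟩, ⟨fun i ↦ H i, fun i ↦ (H i).2, hH.symm⟩⟩
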